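/- Let $r, c > 0$ be integers, $n = r + c$, and let $X_1 \subseteq \{0,1\}^n$ be the set of strings whose last $c$ bits are $0$ and $X_2 \subseteq \{0,1\}^n$ the set of strings whose first $r$ bits are $0$. An $X$-pair of a permutation $\varphi$ of $\{0,1\}^n$ is a pair $(x,y) \in X_1 \times X_2$ with $\varphi(x) = y$; write $X_\varphi$ for the set of $X$-pairs of $\varphi$. Let $\mathcal D_X$ be the distribution on permutations of $\{0,1\}^n$ with $$\Pr_{\Phi \sim \mathcal D_X}[\Phi = \varphi] = \frac{|X_\varphi|}{\sum_{\sigma} |X_\sigma|},$$ where $\sigma$ ranges over all permutations of $\{0,1\}^n$. Theorem. Let $T \ge 0$, and let $\mathcal A$ be any quantum algorithm (with an arbitrary finite-dimensional workspace and arbitrary quantum operations, including measurements, before, between and after its queries) that makes at most $T$ quantum queries, each of them to $|x\rangle|y\rangle \mapsto |x\rangle|y \oplus \varphi(x)\rangle$ or to $|x\rangle|y\rangle \mapsto |x\rangle|y \oplus \varphi^{-1}(x)\rangle$ (possibly in superposition). Let $\epsilon$ be the probability, over $\varphi \sim \mathcal D_X$ and the measurements of $\mathcal A$, that $\mathcal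 A$ outputs an $X$-pair of $\varphi$. Then $$\epsilon \le \frac{80\,(T+1)^2}{2^{\min(r,c)}}.$$ -/

import Mathlib

/-- Bit strings of length `n`. -/
abbrev BitString (n : ℕ) : Type := Fin n → Bool

/-- Bitwise addition modulo 2. -/
def bitXor {n : ℕ} (x y : BitString n) : BitString n := fun i => xor (x i) (y i)

section SubsetPairs

variable {α : Type*} [Fintype α] [DecidableEq α]

/-- `(x, y)` is an `(X₁, X₂)`-pair of the permutation `φ`. -/
def IsSubsetPair (X₁ X₂ : Finset α) (φ : Equiv.Perm α) (x y : α) : Prop :=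
  x ∈ X₁ ∧ y ∈ X₂ ∧ φ x = y

instance (X₁ X₂ : Finset α) (φ : Equiv.Perm α) (x y : α) :
    Decidable (IsSubsetPair X₁ X₂ φ x y) := by
  unfold IsSubsetPair; infer_instance

/-- The number of `(X₁, X₂)`-pairs of `φ`. -/
def numSubsetPairs (X₁ X₂ : Finset α) (φ : Equiv.Perm α) : ℕ :=
  (Finset.univ.filter fun p : α × α => IsSubsetPair X₁ X₂ φ p.1 p.2).card

/-- The probability mass that the non-uniform distribution gives to the permutation `φ`: each
permutation is weighted by its number of `(X₁, X₂)`-pairs. -/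
noncomputable def nonUniformDist (X₁ X₂ : Finset α) (φ : Equiv.Perm α) : ℝ :=
  (numSubsetPairs X₁ X₂ φ : ℝ) / ∑ σ : Equiv.Perm α, (numSubsetPairs X₁ X₂ σ : ℝ)

end SubsetPairs

/-- The bit strings of length `r + c` whose last `c` bits are zero. -/
def endsInZeros (r c : ℕ) : Finset (BitString (r + c)) :=
  Finset.univ.filter fun x => ∀ i : Fin c, x (Fin.natAdd r i) = false

/-- The bit strings of length `r + c` whose first `r` bits are zero. -/
def beginsWithZeros (r c : ℕ) : Finset (BitString (r + c)) :=
  Finset.univ.filter fun x => ∀ i : Fin r, x (Fin.castAdd c i) = false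

/-- What a call to the oracle does: nothing, a query to `φ`, or a query to `φ⁻¹`. -/
inductive QueryMode : Type
  | idle
  | forward
  | inverse
  deriving DecidableEq

instance : Fintype QueryMode where
  elems := {.idle, .forward, .inverse}
  complete m := by cases m <;> simp

/-- Computational basis of the registers of an algorithm: query mode, query input, query output,
and a workspace of dimension `w`. -/
abbrev RegBasis (n w : ℕ) : Type := QueryMode × BitString n × BitString n × Fin w

/-- Action of the oracle on basis states:
`|x, y⟩ ↦ |x, y ⊕ φ(x)⟩` in forward mode and `|x, y⟩ ↦ |x, y ⊕ φ⁻¹(x)⟩` in inverse mode. -/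
def oracleMap {n w : ℕ} (φ : Equiv.Perm (BitString n)) : RegBasis n w → RegBasis n w
  | (.idle, x, y, z) => (.idle, x, y, z)
  | (.forward, x, y, z) => (.forward, x, bitXor y (φ x), z)
  | (.inverse, x, y, z) => (.inverse, x, bitXor y (φ.symm x), z)

/-- The oracle unitary, `|b⟩ ↦ |oracleMap φ b⟩`. -/
def oracleMatrix {n : ℕ} (w : ℕ) (φ : Equiv.Perm (BitString n)) :
    Matrix (RegBasis n w) (RegBasis n w) ℂ :=
  Matrix.of fun a b => if a = oracleMap φ b then 1 else 0

/-- A quantum algorithm on `n`-bit permutations making (at most) `T` oracle queries. It starts in a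
basis state, applies arbitrary quantum operations (completely positive trace-preserving maps, given
by Kraus operators; these include unitary gates and intermediate measurements whose outcomes are
stored in the workspace) before, between and after its queries, measures all registers in the
computational basis, and returns a pair of strings computed from the outcome. None of these data
depend on the permutation. -/
structure QueryAlgorithm (n T : ℕ) where
  /-- dimension of the workspace -/
  workDim : ℕ
  /-- number of Kraus operators of each operation -/
  krausNum : ℕ
  /-- initial basis state -/
  start : RegBasis n workDim
  /-- Kraus operators of the operations: number `0` is applied before the first query, and number
  `i + 1` after query `i` -/
  kraus : Fin (T + 1) → Fin krausNum → Matrix (RegBasis n workDim) (RegBasis n workDim) ℂ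
  /-- the operations preserve the trace -/
  kraus_complete : ∀ i, ∑ k, (kraus i k).conjTranspose * kraus i k = 1
  /-- the pair of strings returned on each measurement outcome -/
  output : RegBasis n workDim → BitString n × BitString n

namespace QueryAlgorithm

variable {n T : ℕ} (A : QueryAlgorithm n T)

/-- The `i`-th operation of the algorithm, `ρ ↦ ∑ₖ Kₖ ρ Kₖ†`. -/
def channel (i : Fin (T + 1))
    (ρ : Matrix (RegBasis n A.workDim) (RegBasis n A.workDim) ℂ) :
    Matrix (RegBasis n A.workDim) (RegBasis n A.workDim) ℂ :=
  ∑ k, A.kraus i k * ρ * (A.kraus i k).conjTranspose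

/-- The density matrix after `i` queries and the operation that follows them. -/
def state (φ : Equiv.Perm (BitString n)) :
    Fin (T + 1) → Matrix (RegBasis n A.workDim) (RegBasis n A.workDim) ℂ :=
  Fin.induction
    (A.channel 0 (Matrix.single A.start A.start 1))
    (fun i ρ => A.channel i.succ
      (oracleMatrix A.workDim φ * ρ * (oracleMatrix A.workDim φ).conjTranspose))

/-- The probability that the final measurement, on oracle `φ`, makes the algorithm return an
`(X₁, X₂)`-pair of `φ`. -/
noncomputable def successProb (X₁ X₂ : Finset (BitString n)) (φ : Equiv.Perm (BitString n)) : ℝ :=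
  ∑ b : RegBasis n A.workDim,
    if IsSubsetPair X₁ X₂ φ (A.output b).1 (A.output b).2 then
      (A.state φ (Fin.last T) b b).re else 0

end QueryAlgorithm

/-! Planting reduces the search to a comparison of two runs. Success on `φ` is a sum over its pairs
`(x, y)`, and a uniform `φ` altered at two points so that `x ↦ y` is uniform among the permutations
with `φ x = y` (`sum_plant`). So the success probability becomes an average, over uniform `φ`, of
the sum over all `(x, y) ∈ X₁ × X₂` of the probability that `(x, y)` is returned on the planted
permutation (`card_mul_sum_pairs`). Planting adds at most two pairs, and the mean number of pairs is
1, so the non-uniform weight costs only a factor 3.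

The run on the unplanted `φ` is independent of `(x, y)`: its probabilities of returning the various
pairs sum to at most 1. The planted oracle differs from it only at the forward inputs `x`, `φ⁻¹ y`
and the inverse inputs `φ x`, `y`. A query has total weight 1, so its weight there, summed over all
pairs, is at most `|X₁| + |X₂|`. The hybrid argument (`weight_state_le_hybrid`) then bounds the sum
over pairs by `2 + 8 T² (|X₁| + |X₂|)`, and division by `2ⁿ = |X₁| |X₂|` gives order `T² / min
(|X₁|, |X₂|)`. -/

/-! ### Purifications and Kraus operators -/

open scoped Matrix.Norms.Frobenius in
theorem frobenius_norm_sq {m n : Type*} [Fintype m] [Fintype n] (M : Matrix m n ℂ) :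
    ‖M‖ ^ 2 = ∑ i, ∑ j, ‖M i j‖ ^ 2 := by
  rw [Matrix.frobenius_norm_def, ← Real.sqrt_eq_rpow, Real.sq_sqrt (by positivity)]
  simp

theorem re_mul_conjTranspose_diag {m n : Type*} [Fintype n] (M : Matrix m n ℂ) (i : m) :
    ((M * M.conjTranspose) i i).re = ∑ j, ‖M i j‖ ^ 2 := by
  simp only [Matrix.mul_apply, Matrix.conjTranspose_apply, RCLike.star_def, Complex.mul_conj,
    Complex.normSq_eq_norm_sq, Complex.re_sum, Complex.ofReal_re]

theorem ofReal_sum_norm_sq_eq_trace {m n : Type*} [Fintype m] [Fintype n] (M : Matrix m n ℂ) :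
    ((∑ i, ∑ j, ‖M i j‖ ^ 2 : ℝ) : ℂ) = (M.conjTranspose * M).trace := by
  rw [Finset.sum_comm]
  simp [Matrix.trace, Matrix.mul_apply, Complex.conj_mul']

/-- The matrices `Kₖ M` side by side. -/
def krausStack {m n κ : Type*} [Fintype m] (K : κ → Matrix m m ℂ) (M : Matrix m n ℂ) :
    Matrix m (κ × n) ℂ :=
  Matrix.of fun i p => (K p.1 * M) i p.2

theorem krausStack_sub {m n κ : Type*} [Fintype m] (K : κ → Matrix m m ℂ) (M M' : Matrix m n ℂ) :
    krausStack K M - krausStack K M' = krausStack K (M - M') := by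
  ext i p
  simp [krausStack, Matrix.mul_sub]

/-- The new column index `κ` acts as an environment: if `M` purifies a state, the stack purifies its
image under the channel. -/
theorem krausStack_mul_conjTranspose {m n κ : Type*} [Fintype m] [Fintype n] [Fintype κ]
    (K : κ → Matrix m m ℂ) (M : Matrix m n ℂ) :
    krausStack K M * (krausStack K M).conjTranspose =
      ∑ k, K k * (M * M.conjTranspose) * (K k).conjTranspose := by
  have h : ∀ k, K k * (M * M.conjTranspose) * (K k).conjTranspose =
      (K k * M) * (K k * M).conjTranspose := fun k => by
    rw [Matrix.conjTranspose_mul]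
    simp only [Matrix.mul_assoc]
  simp_rw [h]
  ext i j
  simp only [Matrix.sum_apply, Matrix.mul_apply (M := krausStack K M), Fintype.sum_prod_type]
  refine Finset.sum_congr rfl fun k _ => ?_
  rw [Matrix.mul_apply]
  rfl

-- This is the Stinespring isometry: cyclicity of the trace brings the Kraus operators together as
-- `∑ Kₖ† Kₖ = 1`.
open scoped Matrix.Norms.Frobenius in
theorem norm_krausStack {m n κ : Type*} [Fintype m] [DecidableEq m] [Fintype n] [Fintype κ]
    (K : κ → Matrix m m ℂ) (hK : ∑ k, (K k).conjTranspose * K k = 1) (M : Matrix m n ℂ) :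
    ‖krausStack K M‖ = ‖M‖ := by
  rw [← sq_eq_sq₀ (norm_nonneg _) (norm_nonneg _), ← Complex.ofReal_inj, frobenius_norm_sq,
    frobenius_norm_sq, ofReal_sum_norm_sq_eq_trace, Matrix.trace_mul_comm,
    krausStack_mul_conjTranspose, Matrix.trace_sum, ofReal_sum_norm_sq_eq_trace,
    Matrix.trace_mul_comm _ M]
  nth_rw 2 [← Matrix.one_mul (M * _)]
  rw [← hK, Matrix.sum_mul, Matrix.trace_sum]
  refine Finset.sum_congr rfl fun k _ => ?_
  rw [Matrix.trace_mul_comm, Matrix.mul_assoc]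

/-! ### Action of the oracle and the effect of changing it -/

theorem bitXor_bitXor {n : ℕ} (x y : BitString n) : bitXor (bitXor x y) y = x := by
  funext i
  simp [bitXor]

theorem oracleMap_involutive {n w : ℕ} (φ : Equiv.Perm (BitString n)) :
    Function.Involutive (oracleMap (w := w) φ) := by
  rintro ⟨_ | _ | _, x, y, z⟩ <;> simp [oracleMap, bitXor_bitXor]

theorem oracleMatrix_mul_apply {n w : ℕ} {J : Type*} (φ : Equiv.Perm (BitString n))
    (M : Matrix (RegBasis n w) J ℂ) (a : RegBasis n w) (j : J) :
    (oracleMatrix w φ * M) a j = M (oracleMap φ a) j := by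
  have h : ∀ b, a = oracleMap φ b ↔ oracleMap φ a = b := fun b =>
    (oracleMap_involutive φ).eq_iff.symm
  simp [Matrix.mul_apply, oracleMatrix, h]

/-- The probability of measuring a basis state with property `p` in the state `ρ`. -/
def weight {B : Type*} [Fintype B] (ρ : Matrix B B ℂ) (p : B → Prop) [DecidablePred p] : ℝ :=
  ∑ b, if p b then (ρ b b).re else 0

theorem weight_mul_conjTranspose {B J : Type*} [Fintype B] [Fintype J] (W : Matrix B J ℂ)
    (p : B → Prop) [DecidablePred p] :
    weight (W * W.conjTranspose) p = ∑ b, if p b then ∑ j, ‖W b j‖ ^ 2 else 0 := by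
  simp only [weight, re_mul_conjTranspose_diag]

/-- The query made in the basis state `b` is answered differently by `φ` and `ψ`. -/
def Disagree {n w : ℕ} (φ ψ : Equiv.Perm (BitString n)) (b : RegBasis n w) : Prop :=
  (b.1 = .forward ∧ φ b.2.1 ≠ ψ b.2.1) ∨ (b.1 = .inverse ∧ φ.symm b.2.1 ≠ ψ.symm b.2.1)

instance {n w : ℕ} (φ ψ : Equiv.Perm (BitString n)) :
    DecidablePred (Disagree (w := w) φ ψ) := fun b => by
  unfold Disagree; infer_instance

theorem oracleMap_eq_of_not_disagree {n w : ℕ} {φ ψ : Equiv.Perm (BitString n)}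
    {b : RegBasis n w} (h : ¬ Disagree φ ψ b) : oracleMap φ b = oracleMap ψ b := by
  obtain ⟨_ | _ | _, x, y, z⟩ := b <;> simp_all [oracleMap, Disagree]

theorem disagree_oracleMap {n w : ℕ} (φ ψ σ : Equiv.Perm (BitString n)) (b : RegBasis n w) :
    Disagree φ ψ (oracleMap σ b) ↔ Disagree φ ψ b := by
  obtain ⟨_ | _ | _, x, y, z⟩ := b <;> simp [oracleMap, Disagree]

open scoped Matrix.Norms.Frobenius in
theorem norm_oracleMatrix_mul {n w : ℕ} {J : Type*} [Fintype J] (φ : Equiv.Perm (BitString n))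
    (M : Matrix (RegBasis n w) J ℂ) : ‖oracleMatrix w φ * M‖ = ‖M‖ := by
  rw [← sq_eq_sq₀ (norm_nonneg _) (norm_nonneg _), frobenius_norm_sq, frobenius_norm_sq]
  simp_rw [oracleMatrix_mul_apply]
  exact Equiv.sum_comp (oracleMap_involutive φ).toPerm fun a => ∑ j, ‖M a j‖ ^ 2

theorem norm_sub_sq_le {E : Type*} [SeminormedAddCommGroup E] (x y : E) :
    ‖x - y‖ ^ 2 ≤ 2 * ‖x‖ ^ 2 + 2 * ‖y‖ ^ 2 := by
  nlinarith [norm_sub_le x y, norm_nonneg (x - y), sq_nonneg (‖x‖ - ‖y‖)]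

-- Only rows in `Disagree` contribute. A query preserves mode and input, so either oracle permutes
-- these rows among themselves, and each of the two terms of `norm_sub_sq_le` gives twice the
-- weight.
open scoped Matrix.Norms.Frobenius in
theorem norm_oracleMatrix_mul_sub_sq_le {n w : ℕ} {J : Type*} [Fintype J]
    (φ ψ : Equiv.Perm (BitString n)) (W : Matrix (RegBasis n w) J ℂ) :
    ‖oracleMatrix w φ * W - oracleMatrix w ψ * W‖ ^ 2 ≤
      4 * weight (W * W.conjTranspose) (Disagree φ ψ) := by
  have hperm : ∀ σ : Equiv.Perm (BitString n),
      ∑ b, (if Disagree φ ψ b then ∑ j, ‖W (oracleMap σ b) j‖ ^ 2 else 0) =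
        weight (W * W.conjTranspose) (Disagree φ ψ) := fun σ => by
    rw [weight_mul_conjTranspose, ← Equiv.sum_comp (oracleMap_involutive σ).toPerm]
    simp [disagree_oracleMap, (oracleMap_involutive σ) _]
  have hle : ‖oracleMatrix w φ * W - oracleMatrix w ψ * W‖ ^ 2 ≤
      2 * ∑ b, (if Disagree φ ψ b then ∑ j, ‖W (oracleMap φ b) j‖ ^ 2 else 0) +
      2 * ∑ b, (if Disagree φ ψ b then ∑ j, ‖W (oracleMap ψ b) j‖ ^ 2 else 0) := by
    rw [frobenius_norm_sq, Finset.mul_sum, Finset.mul_sum, ← Finset.sum_add_distrib]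
    refine Finset.sum_le_sum fun b _ => ?_
    simp_rw [Matrix.sub_apply, oracleMatrix_mul_apply]
    split_ifs with hb
    · rw [Finset.mul_sum, Finset.mul_sum, ← Finset.sum_add_distrib]
      exact Finset.sum_le_sum fun j _ => norm_sub_sq_le _ _
    · simp [oracleMap_eq_of_not_disagree hb]
  rw [hperm, hperm] at hle
  linarith

theorem weight_le_add_norm_sub {B J : Type*} [Fintype B] [Fintype J] (V W : Matrix B J ℂ)
    (p : B → Prop) [DecidablePred p] :
    weight (V * V.conjTranspose) p ≤
      2 * weight (W * W.conjTranspose) p + 2 * ∑ b, ∑ j, ‖(V - W) b j‖ ^ 2 := by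
  rw [weight_mul_conjTranspose, weight_mul_conjTranspose, Finset.mul_sum, Finset.mul_sum,
    ← Finset.sum_add_distrib]
  refine Finset.sum_le_sum fun b _ => ?_
  split_ifs
  · rw [Finset.mul_sum, Finset.mul_sum, ← Finset.sum_add_distrib]
    refine Finset.sum_le_sum fun j _ => ?_
    simpa [norm_sub_rev (W b j)] using norm_sub_sq_le (W b j) (-(V - W) b j)
  · positivity

/-! ### The hybrid argument -/

namespace QueryAlgorithm

variable {n T : ℕ} (A : QueryAlgorithm n T)

open scoped Matrix.Norms.Frobenius in
/-- Purifications of the states on two oracles stay close to each other as long as the algorithm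
on the second oracle puts little weight on the queries that tell the oracles apart. -/
theorem exists_close_purifications (φ ψ : Equiv.Perm (BitString n)) (i : Fin (T + 1)) :
    ∃ (J : Type) (_ : Fintype J) (V W : Matrix (RegBasis n A.workDim) J ℂ),
      A.state φ i = V * V.conjTranspose ∧ A.state ψ i = W * W.conjTranspose ∧ ‖W‖ = 1 ∧
      ‖V - W‖ ≤ ∑ t : Fin T, if t.castSucc < i then
        2 * √(weight (A.state ψ t.castSucc) (Disagree φ ψ)) else 0 := by
  induction i using Fin.induction with
  | zero =>
    let V : Matrix (RegBasis n A.workDim) Unit ℂ := Matrix.single A.start () 1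
    have hV : V * V.conjTranspose = Matrix.single A.start A.start 1 := by
      simp [V, Matrix.conjTranspose_single]
    have hs : ∀ σ, A.state σ 0 = krausStack (A.kraus 0) V *
        (krausStack (A.kraus 0) V).conjTranspose := fun σ => by
      rw [krausStack_mul_conjTranspose, hV]
      rfl
    refine ⟨_, inferInstance, _, _, hs φ, hs ψ, ?_, by simp⟩
    rw [norm_krausStack _ (A.kraus_complete 0),
      ← sq_eq_sq₀ (norm_nonneg _) zero_le_one, frobenius_norm_sq]
    simp [V, Matrix.single_apply, apply_ite]
  | succ i ih =>
    obtain ⟨J, _, V, W, hV, hW, hn, hd⟩ := ih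
    have hs : ∀ σ (M : Matrix (RegBasis n A.workDim) J ℂ),
        A.state σ i.castSucc = M * M.conjTranspose →
        A.state σ i.succ = krausStack (A.kraus i.succ) (oracleMatrix A.workDim σ * M) *
          (krausStack (A.kraus i.succ) (oracleMatrix A.workDim σ * M)).conjTranspose := by
      intro σ M hM
      rw [krausStack_mul_conjTranspose, Matrix.conjTranspose_mul]
      have : A.state σ i.succ = A.channel i.succ (oracleMatrix A.workDim σ *
        A.state σ i.castSucc * (oracleMatrix A.workDim σ).conjTranspose) := rfl
      rw [this, hM, channel]
      simp only [Matrix.mul_assoc]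
    refine ⟨_, inferInstance, _, _, hs φ V hV, hs ψ W hW, ?_, ?_⟩
    · rw [norm_krausStack _ (A.kraus_complete _), norm_oracleMatrix_mul, hn]
    · rw [krausStack_sub, norm_krausStack _ (A.kraus_complete _)]
      have hsum : (∑ t : Fin T, if t.castSucc < i.succ then
          2 * √(weight (A.state ψ t.castSucc) (Disagree φ ψ)) else 0) =
          (∑ t : Fin T, if t.castSucc < i.castSucc then
            2 * √(weight (A.state ψ t.castSucc) (Disagree φ ψ)) else 0) +
          2 * √(weight (A.state ψ i.castSucc) (Disagree φ ψ)) := by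
        rw [← Finset.sum_filter, ← Finset.sum_filter]
        have : (Finset.univ.filter fun t : Fin T => t.castSucc < i.succ) =
            insert i (Finset.univ.filter fun t : Fin T => t.castSucc < i.castSucc) := by
          ext t
          simp [Fin.castSucc_lt_succ_iff, le_iff_eq_or_lt]
        rw [this, Finset.sum_insert (by simp), add_comm]
      have hq : ‖oracleMatrix A.workDim φ * W - oracleMatrix A.workDim ψ * W‖ ≤
          2 * √(weight (A.state ψ i.castSucc) (Disagree φ ψ)) := by
        have h4 : (2 : ℝ) = √4 := by
          rw [show (4 : ℝ) = 2 ^ 2 by norm_num, Real.sqrt_sq zero_le_two]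
        rw [h4, ← Real.sqrt_mul (by norm_num), hW]
        exact Real.le_sqrt_of_sq_le (norm_oracleMatrix_mul_sub_sq_le φ ψ W)
      -- Splitting off `V - W` under the oracle `φ` charges the new error to `W`, that is, to the
      -- run on `ψ`.
      calc _ = ‖oracleMatrix A.workDim φ * (V - W) +
            (oracleMatrix A.workDim φ * W - oracleMatrix A.workDim ψ * W)‖ := by
              rw [Matrix.mul_sub]; congr 1; abel
        _ ≤ ‖V - W‖ + 2 * √(weight (A.state ψ i.castSucc) (Disagree φ ψ)) := by
              refine (norm_add_le _ _).trans (add_le_add (norm_oracleMatrix_mul _ _).le hq)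
        _ ≤ _ := by rw [hsum]; gcongr

theorem state_diag_nonneg (φ : Equiv.Perm (BitString n)) (i : Fin (T + 1))
    (b : RegBasis n A.workDim) : 0 ≤ (A.state φ i b b).re := by
  -- Comparing `φ` with itself just supplies a purification.
  obtain ⟨J, _, V, W, hV, -⟩ := A.exists_close_purifications φ φ i
  rw [hV, re_mul_conjTranspose_diag]
  positivity

theorem sum_state_diag (φ : Equiv.Perm (BitString n)) (i : Fin (T + 1)) :
    ∑ b, (A.state φ i b b).re = 1 := by
  obtain ⟨J, _, V, W, -, hW, hn, -⟩ := A.exists_close_purifications φ φ i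
  simp_rw [hW, re_mul_conjTranspose_diag, ← frobenius_norm_sq, hn, one_pow]

theorem weight_state_nonneg (φ : Equiv.Perm (BitString n)) (i : Fin (T + 1))
    (p : RegBasis n A.workDim → Prop) [DecidablePred p] : 0 ≤ weight (A.state φ i) p :=
  Finset.sum_nonneg fun b _ => by
    split_ifs
    exacts [A.state_diag_nonneg φ i b, le_rfl]

-- The distance of the purifications is at most a sum of `T` terms `2√w`; by Cauchy–Schwarz its
-- square is at most `4 T ∑ w`, doubled by `weight_le_add_norm_sub`.
open scoped Matrix.Norms.Frobenius in
theorem weight_state_le_hybrid (φ ψ : Equiv.Perm (BitString n))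
    (p : RegBasis n A.workDim → Prop) [DecidablePred p] :
    weight (A.state φ (Fin.last T)) p ≤ 2 * weight (A.state ψ (Fin.last T)) p +
      8 * T * ∑ t : Fin T, weight (A.state ψ t.castSucc) (Disagree φ ψ) := by
  obtain ⟨J, _, V, W, hV, hW, -, hd⟩ := A.exists_close_purifications φ ψ (Fin.last T)
  simp only [Fin.castSucc_lt_last, if_true] at hd
  have hsq := pow_le_pow_left₀ (norm_nonneg _) hd 2
  have hcs := sq_sum_le_card_mul_sum_sq (s := (Finset.univ : Finset (Fin T)))
    (f := fun t => 2 * √(weight (A.state ψ t.castSucc) (Disagree φ ψ)))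
  simp_rw [mul_pow, Real.sq_sqrt (A.weight_state_nonneg _ _ _), ← Finset.mul_sum,
    Finset.card_univ, Fintype.card_fin] at hcs
  have h := weight_le_add_norm_sub V W p
  rw [← hV, ← hW, ← frobenius_norm_sq] at h
  simp only [← Finset.mul_sum, mul_pow] at hsq hcs
  linarith

end QueryAlgorithm

/-! ### Planting a pair in a random permutation -/

/-- The permutation `φ`, changed at two points so that it sends `x` to `y`. -/
def plant {α : Type*} [DecidableEq α] (φ : Equiv.Perm α) (x y : α) : Equiv.Perm α :=
  Equiv.swap (φ x) y * φ

theorem plant_apply_of_ne {α : Type*} [DecidableEq α] (φ : Equiv.Perm α) {x y u : α}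
    (hx : u ≠ x) (hy : φ u ≠ y) :
    plant φ x y u = φ u :=
  Equiv.swap_apply_of_ne_of_ne (φ.injective.ne hx) hy

theorem plant_symm_apply_of_ne {α : Type*} [DecidableEq α] (φ : Equiv.Perm α) {x y v : α}
    (hx : v ≠ φ x) (hy : v ≠ y) :
    (plant φ x y).symm v = φ.symm v := by
  rw [Equiv.symm_apply_eq, plant_apply_of_ne, Equiv.apply_symm_apply]
  · exact fun h => hx (by rw [← h, Equiv.apply_symm_apply])
  · simpa using hy

/-- Planting `x ↦ y` in a uniformly random permutation gives a uniformly random permutation among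
those that send `x` to `y`. -/
theorem sum_plant {α : Type*} [Fintype α] [DecidableEq α]
    (F : Equiv.Perm α → ℝ) (x y : α) :
    ∑ φ : Equiv.Perm α, F (plant φ x y) =
      Fintype.card α * ∑ φ : Equiv.Perm α, if φ x = y then F φ else 0 := by
  -- Composing with `swap z y` maps the permutations with `φ x = z` bijectively to those with `φ x =
  -- y`, and on the former it is planting. Each of the `|α|` values `z` thus contributes the same
  -- sum.
  have h : ∀ z : α, ∑ φ : Equiv.Perm α, (if φ x = z then F (plant φ x y) else 0) =
      ∑ φ : Equiv.Perm α, if φ x = y then F φ else 0 := fun z => by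
    rw [← Equiv.sum_comp (Equiv.mulLeft (Equiv.swap z y)) fun φ => if φ x = y then F φ else 0]
    refine Finset.sum_congr rfl fun φ _ => ?_
    have hz : Equiv.swap z y (φ x) = y ↔ φ x = z := by
      rw [Equiv.swap_apply_eq_iff, Equiv.swap_apply_right]
    simp only [Equiv.coe_mulLeft, Equiv.Perm.mul_apply, hz]
    split_ifs with hx
    · rw [plant, hx]
    · rfl
  calc _ = ∑ φ : Equiv.Perm α, ∑ z, if φ x = z then F (plant φ x y) else 0 := by simp
    _ = _ := by
      rw [Finset.sum_comm, Finset.sum_congr rfl fun z _ => h z]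
      simp

theorem numSubsetPairs_plant_le {α : Type*} [Fintype α] [DecidableEq α]
    (X₁ X₂ : Finset α) (φ : Equiv.Perm α) (x y : α) :
    numSubsetPairs X₁ X₂ (plant φ x y) ≤ numSubsetPairs X₁ X₂ φ + 2 := by
  -- Only `x` and `φ⁻¹ y` can change their image, so any new pair starts at one of them.
  have hsub : (Finset.univ.filter fun p : α × α => IsSubsetPair X₁ X₂ (plant φ x y) p.1 p.2) ⊆
      (Finset.univ.filter fun p : α × α => IsSubsetPair X₁ X₂ φ p.1 p.2) ∪
        {(x, plant φ x y x), (φ.symm y, plant φ x y (φ.symm y))} := by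
    rintro ⟨u, v⟩ h
    simp only [Finset.mem_union, Finset.mem_filter, Finset.mem_univ, true_and, Finset.mem_insert,
      Finset.mem_singleton, Prod.mk.injEq] at h ⊢
    obtain ⟨h1, h2, rfl⟩ := h
    by_cases hx : u = x
    · exact .inr (.inl ⟨hx, by rw [hx]⟩)
    by_cases hy : φ u = y
    · exact .inr (.inr ⟨by rw [← hy, Equiv.symm_apply_apply], by rw [← hy, Equiv.symm_apply_apply]⟩)
    exact .inl ⟨h1, h2, (plant_apply_of_ne φ hx hy).symm⟩
  exact (Finset.card_le_card hsub).trans ((Finset.card_union_le _ _).trans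
    (Nat.add_le_add_left Finset.card_le_two _))

theorem sum_isSubsetPair {α : Type*} [Fintype α] [DecidableEq α]
    (X₁ X₂ : Finset α) (φ : Equiv.Perm α) (f : α × α → ℝ) :
    ∑ p : α × α, (if IsSubsetPair X₁ X₂ φ p.1 p.2 then f p else 0) =
      ∑ x ∈ X₁, ∑ y ∈ X₂, if φ x = y then f (x, y) else 0 := by
  rw [Fintype.sum_prod_type, ← Finset.sum_subset (Finset.subset_univ X₁)]
  · refine Finset.sum_congr rfl fun x hx => ?_
    rw [← Finset.sum_subset (Finset.subset_univ X₂)]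
    · exact Finset.sum_congr rfl fun y hy => by simp [IsSubsetPair, hx, hy]
    · intro y _ hy
      simp [IsSubsetPair, hy]
  · intro x _ hx
    simp [IsSubsetPair, hx]

theorem card_mul_sum_pairs {α : Type*} [Fintype α] [DecidableEq α]
    (X₁ X₂ : Finset α) (F : Equiv.Perm α → α × α → ℝ) :
    Fintype.card α * ∑ φ : Equiv.Perm α,
        ∑ p : α × α, (if IsSubsetPair X₁ X₂ φ p.1 p.2 then F φ p else 0) =
      ∑ φ : Equiv.Perm α, ∑ x ∈ X₁, ∑ y ∈ X₂, F (plant φ x y) (x, y) := by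
  simp_rw [sum_isSubsetPair]
  rw [Finset.sum_comm, Finset.sum_comm (γ := Equiv.Perm α), Finset.mul_sum]
  refine Finset.sum_congr rfl fun x _ => ?_
  rw [Finset.sum_comm, Finset.sum_comm (γ := Equiv.Perm α), Finset.mul_sum]
  exact Finset.sum_congr rfl fun y _ => (sum_plant (fun φ => F φ (x, y)) x y).symm

theorem card_mul_sum_numSubsetPairs {α : Type*} [Fintype α] [DecidableEq α]
    (X₁ X₂ : Finset α) :
    Fintype.card α * ∑ φ : Equiv.Perm α, (numSubsetPairs X₁ X₂ φ : ℝ) =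
      Fintype.card (Equiv.Perm α) * (X₁.card * X₂.card) := by
  have h := card_mul_sum_pairs X₁ X₂ fun _ _ => 1
  simpa [numSubsetPairs, Finset.sum_boole] using h

theorem sum_le_sum_univ {α : Type*} [Fintype α] (s : Finset α) (e : α ≃ α) {f : α → ℝ}
    (hf : ∀ u, 0 ≤ f u) :
    ∑ x ∈ s, f (e x) ≤ ∑ u, f u := by
  rw [← Equiv.sum_comp e f]
  exact Finset.sum_le_sum_of_subset_of_nonneg (Finset.subset_univ s) fun _ _ _ => hf _

theorem disagree_plant {n w : ℕ} {φ : Equiv.Perm (BitString n)} {x y : BitString n}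
    {b : RegBasis n w} (h : Disagree (plant φ x y) φ b) :
    (b.1 = .forward ∧ b.2.1 = x) ∨ (b.1 = .forward ∧ b.2.1 = φ.symm y) ∨
      (b.1 = .inverse ∧ b.2.1 = φ x) ∨ (b.1 = .inverse ∧ b.2.1 = y) := by
  rcases h with ⟨hb, h⟩ | ⟨hb, h⟩
  · by_contra! hc
    exact h (plant_apply_of_ne φ (hc.1 hb) fun hy =>
      hc.2.1 hb ((Equiv.symm_apply_eq φ).2 hy.symm).symm)
  · by_contra! hc
    exact h (plant_symm_apply_of_ne φ (hc.2.2.1 hb) (hc.2.2.2 hb))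

/-! ### Averaging over the planted pair -/

namespace QueryAlgorithm

variable {n T : ℕ} (A : QueryAlgorithm n T)

/-- The weight of the queries with mode `m` and input `u` in the state after `i` queries. -/
noncomputable def queryWeight (φ : Equiv.Perm (BitString n)) (i : Fin (T + 1)) (m : QueryMode)
    (u : BitString n) : ℝ :=
  weight (A.state φ i) fun b => b.1 = m ∧ b.2.1 = u

theorem queryWeight_nonneg (φ : Equiv.Perm (BitString n)) (i : Fin (T + 1)) (m : QueryMode)
    (u : BitString n) : 0 ≤ A.queryWeight φ i m u :=
  A.weight_state_nonneg φ i _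

theorem sum_queryWeight_le (φ : Equiv.Perm (BitString n)) (i : Fin (T + 1)) :
    ∑ u, A.queryWeight φ i .forward u + ∑ u, A.queryWeight φ i .inverse u ≤ 1 := by
  simp only [queryWeight, weight]
  rw [Finset.sum_comm, Finset.sum_comm (γ := BitString n), ← Finset.sum_add_distrib,
    ← A.sum_state_diag φ i]
  refine Finset.sum_le_sum fun b _ => ?_
  have := A.state_diag_nonneg φ i b
  rcases b with ⟨_ | _ | _, x, y, z⟩ <;> simp [this]

theorem weight_disagree_plant_le (φ : Equiv.Perm (BitString n)) (i : Fin (T + 1))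
    (x y : BitString n) :
    weight (A.state φ i) (Disagree (plant φ x y) φ) ≤
      A.queryWeight φ i .forward x + A.queryWeight φ i .forward (φ.symm y) +
        (A.queryWeight φ i .inverse (φ x) + A.queryWeight φ i .inverse y) := by
  simp only [queryWeight, weight, ← Finset.sum_add_distrib]
  refine Finset.sum_le_sum fun b _ => ?_
  have h0 := A.state_diag_nonneg φ i b
  have hite : ∀ (p : Prop) [Decidable p], 0 ≤ if p then (A.state φ i b b).re else 0 :=
    fun p _ => by split_ifs <;> simp [h0]
  split_ifs with h
  any_goals linarith
  · rcases disagree_plant h with h | h | h | h <;> simp_all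

/-- Two of the four query weights depend on `x` alone and two on `y` alone. Summing over the other
variable gives a cardinality; the inputs are distinct because `φ` is injective, so what remains is
at most the total weight 1. -/
theorem sum_weight_disagree_plant_le (X₁ X₂ : Finset (BitString n))
    (φ : Equiv.Perm (BitString n)) (i : Fin (T + 1)) :
    ∑ x ∈ X₁, ∑ y ∈ X₂, weight (A.state φ i) (Disagree (plant φ x y) φ) ≤
      X₁.card + X₂.card := by
  have hf := A.queryWeight_nonneg φ i .forward
  have hg := A.queryWeight_nonneg φ i .inverse
  have h1 := sum_le_sum_univ X₁ (Equiv.refl _) hf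
  have h2 := sum_le_sum_univ X₂ φ.symm hf
  have h3 := sum_le_sum_univ X₁ φ hg
  have h4 := sum_le_sum_univ X₂ (Equiv.refl _) hg
  have h5 := A.sum_queryWeight_le φ i
  have h := Finset.sum_le_sum fun x (_ : x ∈ X₁) => Finset.sum_le_sum fun y (_ : y ∈ X₂) =>
    A.weight_disagree_plant_le φ i x y
  simp only [Finset.sum_add_distrib, Finset.sum_const, nsmul_eq_mul, ← Finset.mul_sum] at h
  simp only [Equiv.refl_apply] at h1 h4
  have c1 : (0 : ℝ) ≤ X₁.card := Nat.cast_nonneg _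
  have c2 : (0 : ℝ) ≤ X₂.card := Nat.cast_nonneg _
  have m1 := mul_le_mul_of_nonneg_left h1 c2
  have m2 := mul_le_mul_of_nonneg_left h2 c1
  have m3 := mul_le_mul_of_nonneg_left h3 c2
  have m4 := mul_le_mul_of_nonneg_left h4 c1
  have m5 := mul_le_mul_of_nonneg_left h5 (add_nonneg c1 c2)
  linarith

/-- The probability that the algorithm returns the pair `p` on oracle `φ`. -/
noncomputable def outputProb (φ : Equiv.Perm (BitString n)) (p : BitString n × BitString n) : ℝ :=
  weight (A.state φ (Fin.last T)) fun b => A.output b = p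

theorem outputProb_nonneg (φ : Equiv.Perm (BitString n)) (p : BitString n × BitString n) :
    0 ≤ A.outputProb φ p :=
  A.weight_state_nonneg φ _ _

theorem sum_outputProb (φ : Equiv.Perm (BitString n)) : ∑ p, A.outputProb φ p = 1 := by
  simp only [outputProb, weight]
  rw [Finset.sum_comm, ← A.sum_state_diag φ (Fin.last T)]
  simp

theorem sum_outputProb_le (X₁ X₂ : Finset (BitString n)) (φ : Equiv.Perm (BitString n)) :
    ∑ x ∈ X₁, ∑ y ∈ X₂, A.outputProb φ (x, y) ≤ 1 := by
  rw [← Finset.sum_product', ← A.sum_outputProb φ]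
  exact Finset.sum_le_sum_of_subset_of_nonneg (Finset.subset_univ _)
    fun p _ _ => A.outputProb_nonneg φ p

theorem successProb_eq_sum (X₁ X₂ : Finset (BitString n)) (φ : Equiv.Perm (BitString n)) :
    A.successProb X₁ X₂ φ =
      ∑ p : BitString n × BitString n,
        if IsSubsetPair X₁ X₂ φ p.1 p.2 then A.outputProb φ p else 0 := by
  simp only [outputProb, weight, ← Finset.sum_filter (p := fun p : BitString n × BitString n =>
    IsSubsetPair X₁ X₂ φ p.1 p.2)]
  rw [Finset.sum_comm]
  simp [successProb]

theorem sum_outputProb_plant_le (X₁ X₂ : Finset (BitString n)) (φ : Equiv.Perm (BitString n)) :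
    ∑ x ∈ X₁, ∑ y ∈ X₂, A.outputProb (plant φ x y) (x, y) ≤
      2 + 8 * (T : ℝ) ^ 2 * (X₁.card + X₂.card) := by
  have hT : ∑ x ∈ X₁, ∑ y ∈ X₂, ∑ t : Fin T,
      weight (A.state φ t.castSucc) (Disagree (plant φ x y) φ) ≤
        T * (X₁.card + X₂.card) := by
    calc _ = ∑ t : Fin T, ∑ x ∈ X₁, ∑ y ∈ X₂,
          weight (A.state φ t.castSucc) (Disagree (plant φ x y) φ) :=
            (Finset.sum_congr rfl fun x _ => Finset.sum_comm).trans Finset.sum_comm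
      _ ≤ ∑ _t : Fin T, ((X₁.card : ℝ) + X₂.card) :=
            Finset.sum_le_sum fun t _ => A.sum_weight_disagree_plant_le X₁ X₂ φ _
      _ = _ := by simp [mul_add]
  have h := Finset.sum_le_sum fun x (_ : x ∈ X₁) => Finset.sum_le_sum fun y (_ : y ∈ X₂) =>
    A.weight_state_le_hybrid (plant φ x y) φ fun b => A.output b = (x, y)
  simp only [Finset.sum_add_distrib, ← Finset.mul_sum] at h
  have h1 := A.sum_outputProb_le X₁ X₂ φ
  have h2 := mul_le_mul_of_nonneg_left hT (by positivity : (0 : ℝ) ≤ 8 * T)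
  simp only [outputProb] at h1 ⊢
  linarith

theorem card_mul_sum_numSubsetPairs_mul_successProb_le (X₁ X₂ : Finset (BitString n)) :
    Fintype.card (BitString n) * ∑ φ : Equiv.Perm (BitString n),
        (numSubsetPairs X₁ X₂ φ : ℝ) * A.successProb X₁ X₂ φ ≤
      (∑ φ : Equiv.Perm (BitString n), ((numSubsetPairs X₁ X₂ φ : ℝ) + 2)) *
        (2 + 8 * (T : ℝ) ^ 2 * (X₁.card + X₂.card)) := by
  simp_rw [successProb_eq_sum, Finset.mul_sum (ι := BitString n × BitString n), mul_ite, mul_zero]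
  rw [card_mul_sum_pairs X₁ X₂ fun φ p => (numSubsetPairs X₁ X₂ φ : ℝ) * A.outputProb φ p,
    Finset.sum_mul]
  refine Finset.sum_le_sum fun φ _ => ?_
  refine le_trans ?_ (mul_le_mul_of_nonneg_left (A.sum_outputProb_plant_le X₁ X₂ φ)
    (by positivity))
  simp_rw [Finset.mul_sum]
  refine Finset.sum_le_sum fun x _ => Finset.sum_le_sum fun y _ => ?_
  exact mul_le_mul_of_nonneg_right (by exact_mod_cast numSubsetPairs_plant_le X₁ X₂ φ x y)
    (A.outputProb_nonneg _ _)

/-- Under `hX` a uniform permutation has one pair on average, so the weights `numSubsetPairs + 2`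
average 3. -/
theorem sum_nonUniformDist_mul_successProb_le (X₁ X₂ : Finset (BitString n))
    (hX : X₁.card * X₂.card = Fintype.card (BitString n)) :
    ∑ φ : Equiv.Perm (BitString n), nonUniformDist X₁ X₂ φ * A.successProb X₁ X₂ φ ≤
      3 * (2 + 8 * (T : ℝ) ^ 2 * (X₁.card + X₂.card)) / (X₁.card * X₂.card) := by
  have hN : (0 : ℝ) < Fintype.card (BitString n) := by exact_mod_cast Fintype.card_pos
  have hP : (0 : ℝ) < Fintype.card (Equiv.Perm (BitString n)) := by
    exact_mod_cast Fintype.card_pos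
  have hX' : (X₁.card : ℝ) * X₂.card = Fintype.card (BitString n) := by exact_mod_cast hX
  have hZ : ∑ σ : Equiv.Perm (BitString n), (numSubsetPairs X₁ X₂ σ : ℝ) =
      Fintype.card (Equiv.Perm (BitString n)) := by
    have := card_mul_sum_numSubsetPairs X₁ X₂
    rw [hX', mul_comm] at this
    exact mul_right_cancel₀ hN.ne' this
  have h := A.card_mul_sum_numSubsetPairs_mul_successProb_le X₁ X₂
  rw [Finset.sum_add_distrib, hZ, Finset.sum_const, Finset.card_univ, nsmul_eq_mul] at h
  simp_rw [nonUniformDist, hZ, div_mul_eq_mul_div, ← Finset.sum_div]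
  rw [hX', div_le_div_iff₀ hP hN]
  linarith

end QueryAlgorithm

/-! ### The two sets of strings and the final bound -/

theorem card_endsInZeros (r c : ℕ) : (endsInZeros r c).card = 2 ^ r := by
  have h : (Finset.univ : Finset (BitString r)).card = (endsInZeros r c).card := by
    refine Finset.card_bij' (fun x _ => Fin.append x fun _ => false)
      (fun x _ i => x (Fin.castAdd c i)) ?_ ?_ ?_ ?_
    · simp [endsInZeros]
    · simp
    · simp
    · intro x hx
      simp only [endsInZeros, Finset.mem_filter, Finset.mem_univ, true_and] at hx
      funext i
      refine Fin.addCases (fun j => ?_) (fun j => ?_) i <;> simp [hx]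
  simpa using h.symm

theorem card_beginsWithZeros (r c : ℕ) : (beginsWithZeros r c).card = 2 ^ c := by
  have h : (Finset.univ : Finset (BitString c)).card = (beginsWithZeros r c).card := by
    refine Finset.card_bij' (fun x _ => Fin.append (fun _ => false) x)
      (fun x _ i => x (Fin.natAdd r i)) ?_ ?_ ?_ ?_
    · simp [beginsWithZeros]
    · simp
    · simp
    · intro x hx
      simp only [beginsWithZeros, Finset.mem_filter, Finset.mem_univ, true_and] at hx
      funext i
      refine Fin.addCases (fun j => ?_) (fun j => ?_) i <;> simp [hx]
  simpa using h.symm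

theorem mainTheorem4 (r c : ℕ) (hr : 0 < r) (hc : 0 < c) (T : ℕ)
    (A : QueryAlgorithm (r + c) T) :
    ∑ φ : Equiv.Perm (BitString (r + c)),
        nonUniformDist (endsInZeros r c) (beginsWithZeros r c) φ *
          A.successProb (endsInZeros r c) (beginsWithZeros r c) φ
      ≤ 80 * ((T : ℝ) + 1) ^ 2 / 2 ^ min r c := by
  refine (A.sum_nonUniformDist_mul_successProb_le _ _ ?_).trans ?_
  · simp [card_endsInZeros, card_beginsWithZeros, pow_add]
  have hT : (0 : ℝ) ≤ T := Nat.cast_nonneg T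
  -- Here `a` is the smaller cardinality: `a + b ≤ 2 b` and `1 ≤ b` bound the numerator by `(6 + 48
  -- T²) b`, and `b` cancels.
  have key : ∀ a b : ℝ, 1 ≤ a → a ≤ b →
      3 * (2 + 8 * (T : ℝ) ^ 2 * (a + b)) / (a * b) ≤ 80 * ((T : ℝ) + 1) ^ 2 / a := by
    intro a b ha hab
    have ha' : 0 < a := by linarith
    have hb' : 0 < b := by linarith
    rw [div_le_div_iff₀ (by positivity) (by positivity)]
    have h1 : 3 * (2 + 8 * (T : ℝ) ^ 2 * (a + b)) ≤ 80 * ((T : ℝ) + 1) ^ 2 * b := by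
      have hb : 1 ≤ b := ha.trans hab
      have h2 := mul_le_mul_of_nonneg_left hab (sq_nonneg (T : ℝ))
      have h3 := mul_nonneg hT (zero_le_one.trans hb)
      have h4 := mul_nonneg (sq_nonneg (T : ℝ)) (zero_le_one.trans hb)
      linarith
    calc _ ≤ 80 * ((T : ℝ) + 1) ^ 2 * b * a := by gcongr
      _ = _ := by ring
  simp only [card_endsInZeros, card_beginsWithZeros, Nat.cast_pow, Nat.cast_ofNat]
  rcases le_total r c with h | h
  · rw [min_eq_left h]
    exact key _ _ (one_le_pow₀ one_le_two) (pow_le_pow_right₀ one_le_two h)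
  · rw [min_eq_right h, add_comm ((2 : ℝ) ^ r), mul_comm ((2 : ℝ) ^ r)]
    exact key _ _ (one_le_pow₀ one_le_two) (pow_le_pow_right₀ one_le_two h)
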